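/- Let $\Bbbk$ be an algebraically closed field of characteristic $0$, let $\mathcal S=\Bbbk[X_0,\dots,X_n]$ and $\mathcal R=\Bbbk[Y_0,\dots,Y_n]$, and let $\mathcal R$ act on $\mathcal S$ by differentiation, $(G,F)\mapsto G\circ F$, with $Y_i$ acting as $\partial/\partial X_i$. Regard $\mathcal R$ as the homogeneous coordinate ring of $\mathbb P^n=\mathbb P(\mathcal S_1)$, and for a closed subscheme $Z\subset\mathbb P^n$ let $I(Z)\subseteq\mathcal R$ be its saturated homogeneous ideal. For a nonzero $L\in\mathcal S_1$ let $\wp_L\subset\mathcal R$ be the ideal of the point $[L]$, generated by the linear forms $G\in\mathcal R_1$ with $G\circ L=0$. A $0$-dimensional scheme $Z\subset\mathbb P^n$ is *apolar* to $F\in\mathcal S_d$ if $G\circ F=0$ for all $G\in I(Z)$; it is *irredundant* to $F$ if it is apolar to $F$ and no strict $0$-dimensional subscheme $Z'\subsetneq Z$ is apolar to $F$. Let $\mathrm{HF}_Z(i)=\dim_\Bbbk \mathcal R_i/(I(Z)\cap\mathcal R_i)$ and $\mathrm{reg}(Z)=\min\{i\in\mathbb N : \mathrm{HF}_Z(i)=\mathrm{HF}_Z(i+1)=\mathrm{len}(Z)\}$;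 $Z$ is *$d$-regular* if $\mathrm{reg}(Z)\le d$. **Corollary.** Let $d\ge 0$ and $F\in\mathcal S_d$, and let $L_1,\dots,L_s\in\mathcal S_1$ be $\Bbbk$-linearly independent linear forms. Let $Z=\bigcup_{i=1}^s Z_i\subset\mathbb P^n$ be a $0$-dimensional scheme that is apolar and irredundant to $F$, where $Z_1,\dots,Z_s\subset\mathbb P^n$ are $0$-dimensional schemes with $$I(Z_i)\supseteq \wp_{L_i}^{\lceil d/2\rceil+1}\qquad\text{for every } i\in\{1,\dots,s\}.$$ Then $Z$ is $d$-regular. -/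

import Mathlib

noncomputable section

namespace Apolarity

open MvPolynomial

attribute [local instance] MvPolynomial.gradedAlgebra

/-- The polynomial ring `S = k[X_0, …, X_n]`, whose linear forms `L` give the points `[L]` of
`ℙⁿ = ℙ(S_1)`. -/
abbrev PolyS (k : Type*) [Field k] (n : ℕ) := MvPolynomial (Fin (n + 1)) k

/-- The polynomial ring `R = k[Y_0, …, Y_n]`, the coordinate ring of `ℙⁿ = ℙ(S_1)`. -/
abbrev PolyR (k : Type*) [Field k] (n : ℕ) := MvPolynomial (Fin (n + 1)) k

/-- The apolarity action `(G, F) ↦ G ∘ F` of `R` on `S` by differentiation: the bilinear map with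
`Y^β ∘ X^α = α! / (α - β)! X^(α - β)` if `β ≤ α`, and `Y^β ∘ X^α = 0` otherwise. The integer
`α! / (α - β)!` is written as a product of falling factorials; it is `0` unless `β ≤ α`. -/
def diffAction (k : Type*) [Field k] (n : ℕ) : PolyR k n →ₗ[k] PolyS k n →ₗ[k] PolyS k n :=
  (basisMonomials (Fin (n + 1)) k).constr k fun β =>
    (basisMonomials (Fin (n + 1)) k).constr k fun α =>
      monomial (α - β) (∏ i, ((α i).descFactorial (β i) : k))

theorem diffAction_monomial {k : Type*} [Field k] {n : ℕ} (β α : Fin (n + 1) →₀ ℕ) (a b : k) :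
    diffAction k n (monomial β a) (monomial α b) =
      monomial (α - β) (a * b * ∏ i, ((α i).descFactorial (β i) : k)) := by
  have key : diffAction k n (monomial β 1) (monomial α 1) =
      monomial (α - β) (∏ i, ((α i).descFactorial (β i) : k)) := by
    have h1 := (basisMonomials (Fin (n + 1)) k).constr_basis k
      (fun β => (basisMonomials (Fin (n + 1)) k).constr k fun α =>
        monomial (α - β) (∏ i, ((α i).descFactorial (β i) : k))) β
    have h2 := (basisMonomials (Fin (n + 1)) k).constr_basis k
      (fun α => monomial (α - β) (∏ i, ((α i).descFactorial (β i) : k))) α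
    rw [coe_basisMonomials] at h1 h2
    rw [diffAction, h1, h2]
  have ha : (monomial β a : PolyR k n) = a • monomial β 1 := by simp [smul_monomial]
  have hb : (monomial α b : PolyS k n) = b • monomial α 1 := by simp [smul_monomial]
  rw [ha, hb, LinearMap.map_smul₂, LinearMap.map_smul, key]
  simp only [smul_monomial, smul_eq_mul, mul_assoc]

theorem diffAction_mul {k : Type*} [Field k] {n : ℕ} (G H : PolyR k n) (F : PolyS k n) :
    diffAction k n (G * H) F = diffAction k n G (diffAction k n H F) := by
  induction F using MvPolynomial.induction_on' with
  | add p q hp hq => simp only [map_add, hp, hq]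
  | monomial α c =>
    induction H using MvPolynomial.induction_on' with
    | add p q hp hq => simp only [mul_add, map_add, LinearMap.add_apply, hp, hq]
    | monomial β b =>
      induction G using MvPolynomial.induction_on' with
      | add p q hp hq => simp only [add_mul, map_add, LinearMap.add_apply, hp, hq]
      | monomial γ a =>
        rw [monomial_mul, diffAction_monomial, diffAction_monomial, diffAction_monomial]
        have h1 : α - (γ + β) = α - β - γ := by
          ext i; simp only [Finsupp.coe_tsub, Finsupp.coe_add, Pi.sub_apply, Pi.add_apply]; omega
        have h2 : (∏ i, ((α i).descFactorial ((γ + β) i) : k)) =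
            (∏ i, ((α i).descFactorial (β i) : k)) *
              ∏ i, (((α - β) i).descFactorial (γ i) : k) := by
          rw [← Finset.prod_mul_distrib]
          refine Finset.prod_congr rfl fun i _ => ?_
          rw [← Nat.cast_mul]
          congr 1
          have h3 := Nat.descFactorial_mul_descFactorial (n := α i) (k := β i)
            (m := γ i + β i) (by omega)
          rw [Finsupp.add_apply, ← h3, Nat.add_sub_cancel, mul_comm]
          rfl
        rw [h1, h2]
        congr 1
        ring

/-- The annihilator `Ann(F) = {G ∈ R : G ∘ F = 0}`, an ideal of `R`. -/
def ann {k : Type*} [Field k] {n : ℕ} (F : PolyS k n) : Ideal (PolyR k n) where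
  carrier := {G | diffAction k n G F = 0}
  add_mem' {a b} ha hb := by
    simp only [Set.mem_ofPred_eq] at ha hb ⊢
    rw [map_add, LinearMap.add_apply, ha, hb, add_zero]
  zero_mem' := by simp
  smul_mem' c x hx := by
    simp only [Set.mem_ofPred_eq] at hx ⊢
    rw [smul_eq_mul, diffAction_mul, hx, map_zero]

/-- The homogeneous ideal `℘_L ⊆ R` of the point `[L] ∈ ℙ(S_1)`: it is generated by the linear
forms of `R` that annihilate `L`, i.e. that vanish at the coordinate vector of `L`. The `j`-fat
point supported at `[L]` is defined by `℘_L ^ j`. -/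
def pointIdeal {k : Type*} [Field k] {n : ℕ} (L : PolyS k n) : Ideal (PolyR k n) :=
  Ideal.span {G | G.IsHomogeneous 1 ∧ diffAction k n G L = 0}

/-- A `0`-dimensional closed subscheme `Z` of `ℙⁿ`, given by its homogeneous ideal `I(Z) ⊆ R`.
Closed subschemes of `ℙⁿ` correspond bijectively to the homogeneous ideals of `R` that are
saturated with respect to `(Y_0, …, Y_n)`; the subscheme `Proj (R / I)` has dimension `0`
exactly when the ring `R / I` has Krull dimension `1`. -/
structure ZeroDimScheme (k : Type*) [Field k] (n : ℕ) where
  /-- the homogeneous ideal `I(Z)` -/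
  ideal : Ideal (PolyR k n)
  homogeneous : ideal.IsHomogeneous (homogeneousSubmodule (Fin (n + 1)) k)
  saturated : ∀ G : PolyR k n, (∀ i, X i * G ∈ ideal) → G ∈ ideal
  dim_eq_zero : ringKrullDim (PolyR k n ⧸ ideal) = 1

namespace ZeroDimScheme

variable {k : Type*} [Field k] {n : ℕ}

/-- `Z` is apolar to `F` if `I(Z) ⊆ Ann(F)`. -/
def IsApolar (Z : ZeroDimScheme k n) (F : PolyS k n) : Prop :=
  Z.ideal ≤ ann F

/-- `Z` is irredundant to `F`: it is apolar to `F`, and no strict `0`-dimensional subscheme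
`Z' ⊊ Z` (that is, `I(Z) ⊊ I(Z')`) is apolar to `F`. -/
def IsIrredundant (Z : ZeroDimScheme k n) (F : PolyS k n) : Prop :=
  Z.IsApolar F ∧ ¬ ∃ Z' : ZeroDimScheme k n, Z.ideal < Z'.ideal ∧ Z'.IsApolar F

/-- The Hilbert function `HF_Z(i) = dim_k R_i / I(Z)_i`, where `I(Z)_i = I(Z) ∩ R_i`. -/
def hilbertFunction (Z : ZeroDimScheme k n) (i : ℕ) : ℕ :=
  Module.finrank k (homogeneousSubmodule (Fin (n + 1)) k i ⧸
    (Z.ideal.restrictScalars k).comap (homogeneousSubmodule (Fin (n + 1)) k i).subtype)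

/-- The length of `Z`, i.e. the dimension over `k` of the ring of functions on `Z`.
For a linear form `ℓ ∈ R_1`, the part of `Z` in the affine chart `{ℓ ≠ 0}` of `ℙⁿ` is the affine
scheme with coordinate ring `R / (I(Z) + (ℓ - 1))`, which is all of `Z` as soon as the hyperplane
`{ℓ = 0}` misses the finitely many points of `Z`; over an infinite field there is such an `ℓ`, so
that the supremum of the dimensions of these coordinate rings is the length of `Z`. -/
def length (Z : ZeroDimScheme k n) : ℕ∞ :=
  ⨆ (l : PolyR k n) (_ : l.IsHomogeneous 1),
    Module.length k (PolyR k n ⧸ (Z.ideal ⊔ Ideal.span {l - 1}))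

/-- The regularity of `Z`, the least `i` with `HF_Z(i) = HF_Z(i + 1) = len(Z)`
(`⊤` if there were none). -/
def regularity (Z : ZeroDimScheme k n) : ℕ∞ :=
  ⨅ (i : ℕ) (_ : (Z.hilbertFunction i : ℕ∞) = Z.length ∧
    (Z.hilbertFunction (i + 1) : ℕ∞) = Z.length), (i : ℕ∞)

/-- `Z` is `d`-regular if its regularity is at most `d`. -/
def IsRegularInDegree (Z : ZeroDimScheme k n) (d : ℕ) : Prop :=
  Z.regularity ≤ d

end ZeroDimScheme

end Apolarity

end

noncomputable section

namespace Apolarity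

open MvPolynomial

attribute [local instance] MvPolynomial.gradedAlgebra

/-! Choose linear forms `y i` dual to the `L i`. Their sum `l` is `1` at every `L i`, so the chart
`l ≠ 0` contains all of `Z`; let `A = R / (I(Z) + (l - 1))` and let `V` be the image of the forms of
degree `d`. Since `l` is a nonzerodivisor modulo `I(Z)`, regularity in degree `d` follows from `V =
A`.

Put `m = ⌈d/2⌉`. As the `L i` are independent, the points `[L i]` are cut out by forms of degree at
most 2. The ideal `N` of `A` that these generate satisfies `N ^ (m + 1) = 0` by the fat point
hypothesis, `A / N` is spanned by the orthogonal idempotents `y i`, and `V + N ^ m = A`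
(`pow_sup_span_pow_eq_top`).

By apolarity, `G ↦ (G ∘ F)(0)` on forms of degree `d` descends to `V` and extends to a functional
`f` on `A`. By irredundancy, no extension of `f|_V` kills a nonzero proper ideal
(`eq_bot_of_le_ker`). If `V ≠ A`, take `ψ ≠ 0` vanishing on `V`. When `f|_V ≠ 0`, every `f + c • ψ`
is nondegenerate, so `ψ = f(a · )` with `1 + c • a` a unit for every scalar `c`. Hence `a` vanishes
at all the points, that is `a ∈ N`, and `ψ(N ^ m) ⊆ f(N ^ (m + 1)) = 0`. So `ψ` vanishes on `V + N ^
m = A`, a contradiction (`eq_top_of_forall_extension`). -/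

/-! ### Commutative algebra of the finite chart ring -/

theorem pow_sup_span_pow_eq_top {k A : Type*} [Field k] [CommRing A] [Algebra k A]
    (V : Submodule k A) (hone : 1 ∈ V) (T : Set A) (hT : T ⊆ (V ^ 2 : Submodule k A))
    (hV : V ⊔ (Ideal.span T).restrictScalars k = ⊤) (q : ℕ) :
    V ^ (2 * q + 1) ⊔ ((Ideal.span T) ^ (q + 1)).restrictScalars k = ⊤ := by
  have step : ∀ q, ((Ideal.span T) ^ (q + 1)).restrictScalars k ≤
      V ^ (2 * (q + 1) + 1) ⊔ ((Ideal.span T) ^ (q + 2)).restrictScalars k := by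
    intro q x hx
    rw [Submodule.restrictScalars_mem, Ideal.span, Submodule.span_pow] at hx
    induction hx using Submodule.closure_induction with
    | zero => exact zero_mem _
    | add x y _ _ h1 h2 => exact add_mem h1 h2
    | smul_mem a t ht =>
      -- With `a = v + w`, the term `v t` costs one more degree than the product `t` of `q + 1`
      -- generators, and `w t` gains one more factor from the ideal.
      have ha : a ∈ V ⊔ (Ideal.span T).restrictScalars k := hV ▸ Submodule.mem_top
      obtain ⟨v, hv, w, hw, rfl⟩ := Submodule.mem_sup.1 ha
      have ht1 : t ∈ V ^ (2 * (q + 1)) := by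
        rw [pow_mul]
        exact Submodule.pow_subset_pow _ (Set.pow_subset_pow_left hT ht)
      have ht2 : t ∈ Ideal.span T ^ (q + 1) := by
        rw [Ideal.span, Submodule.span_pow]
        exact Submodule.subset_span ht
      rw [add_smul, smul_eq_mul, smul_eq_mul]
      refine Submodule.add_mem_sup ?_ ?_
      · rw [pow_succ, mul_comm v]
        exact Submodule.mul_mem_mul ht1 hv
      · rw [Submodule.restrictScalars_mem, pow_succ, mul_comm w]
        exact Ideal.mul_mem_mul ht2 hw
  induction q with
  | zero => simpa using hV
  | succ q ih =>
    rw [eq_top_iff, ← ih]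
    refine sup_le (le_sup_of_le_left ?_) (step q)
    exact pow_le_pow_right₀ (Submodule.one_le.2 hone) (by omega)

/-- Multiply `∑ j, y j = 1` by `y i`: only the square survives modulo `N`. -/
theorem mul_self_sub_mem_of_sum_eq_one {A ι : Type*} [CommRing A] [Fintype ι]
    (N : Ideal A) (y : ι → A) (hmul : ∀ i j, i ≠ j → y i * y j ∈ N) (hsum : ∑ i, y i = 1) (i : ι) :
    y i * y i - y i ∈ N := by
  classical
  have h1 : y i * y i - y i = - ∑ j ∈ Finset.univ.erase i, y i * y j := by
    have h2 : y i = ∑ j, y i * y j := by rw [← Finset.mul_sum, hsum, mul_one]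
    rw [← Finset.add_sum_erase _ _ (Finset.mem_univ i)] at h2
    linear_combination -h2
  rw [h1]
  exact N.neg_mem (N.sum_mem fun j hj => hmul i j (Finset.ne_of_mem_erase hj).symm)

theorem mul_mem_span_sup {k A ι : Type*} [Field k] [CommRing A] [Algebra k A] [Fintype ι]
    (N : Ideal A) (y : ι → A) (hmul : ∀ i j, i ≠ j → y i * y j ∈ N) (hsum : ∑ i, y i = 1)
    {a b : A} (ha : a ∈ Submodule.span k (Set.range y) ⊔ N.restrictScalars k)
    (hb : b ∈ Submodule.span k (Set.range y) ⊔ N.restrictScalars k) :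
    a * b ∈ Submodule.span k (Set.range y) ⊔ N.restrictScalars k := by
  have hN : N.restrictScalars k ≤ Submodule.span k (Set.range y) ⊔ N.restrictScalars k :=
    le_sup_right
  have key : Submodule.span k (Set.range y) * Submodule.span k (Set.range y) ≤
      Submodule.span k (Set.range y) ⊔ N.restrictScalars k := by
    rw [Submodule.span_mul_span, Submodule.span_le]
    rintro _ ⟨_, ⟨i, rfl⟩, _, ⟨j, rfl⟩, rfl⟩
    by_cases hij : i = j
    · subst hij
      have h1 : y i * y i = y i + (y i * y i - y i) := by ring
      simp only [SetLike.mem_coe]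
      rw [h1]
      exact Submodule.add_mem_sup (Submodule.subset_span ⟨i, rfl⟩)
        (mul_self_sub_mem_of_sum_eq_one N y hmul hsum i)
    · exact hN (hmul i j hij)
  obtain ⟨a, ha', w, hw, rfl⟩ := Submodule.mem_sup.1 ha
  obtain ⟨b, hb', v, hv, rfl⟩ := Submodule.mem_sup.1 hb
  have h2 : (a + w) * (b + v) = a * b + (a * v + w * (b + v)) := by ring
  rw [h2]
  exact add_mem (key (Submodule.mul_mem_mul ha' hb'))
    (hN (N.add_mem (N.mul_mem_left _ hv) (N.mul_mem_right _ hw)))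

/-- The hypothesis `hf` is irredundancy in algebraic form: a nonzero ideal `K` in the kernel would
define a smaller apolar scheme. The unit ideal is excluded since it corresponds to the empty scheme.
-/
theorem eq_top_of_forall_extension {k A ι : Type*} [Field k] [CommRing A] [Algebra k A]
    [Module.Finite k A] [Fintype ι] (N : Ideal A) (y : ι → A) (m : ℕ)
    (hN : N ^ (m + 1) = ⊥) (hmul : ∀ i j, i ≠ j → y i * y j ∈ N) (hsum : ∑ i, y i = 1)
    (hspan : Submodule.span k (Set.range y) ⊔ N.restrictScalars k = ⊤)
    (V : Submodule k A) (hone : 1 ∈ V) (hV : V ⊔ (N ^ m).restrictScalars k = ⊤)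
    (f : A →ₗ[k] k)
    (hf : ∀ φ : A →ₗ[k] k, (∀ x ∈ V, φ x = f x) → ∀ K : Ideal A, K ≠ ⊤ → (∀ x ∈ K, φ x = 0) →
      K = ⊥) : V = ⊤ := by
  classical
  have hidem := mul_self_sub_mem_of_sum_eq_one N y hmul hsum
  by_contra hne
  by_cases hf0 : ∀ x ∈ V, f x = 0
  -- Here `0` is itself an extension, so `A` has no nonzero proper ideal; each `y i` is then `0` or
  -- `1`, and both lie in `V`.
  · have hK : ∀ K : Ideal A, K ≠ ⊤ → K = ⊥ := fun K hK =>
      hf 0 (fun x hx => by simp [hf0 x hx]) K hK fun x _ => rfl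
    have hNb : N = ⊥ := by
      by_cases hNt : N = ⊤
      · rw [hNt, Ideal.top_pow] at hN
        rw [hNt, hN]
      · exact hK N hNt
    apply hne
    rw [eq_top_iff, ← hspan, hNb]
    refine sup_le (Submodule.span_le.2 ?_) ?_
    · rintro _ ⟨i, rfl⟩
      have h3 : y i * y i - y i = 0 := by simpa [hNb] using hidem i
      by_cases h4 : Ideal.span {y i} = ⊤
      · rw [Ideal.span_singleton_eq_top] at h4
        have : y i = 1 := by
          apply h4.mul_left_cancel
          linear_combination h3
        simpa [this] using hone
      · have := hK _ h4
        rw [Ideal.span_singleton_eq_bot] at this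
        simp [this]
    · intro x hx
      have : x = 0 := by simpa using hx
      simp [this]
  push Not at hf0
  obtain ⟨v, hvV, hv⟩ := hf0
  -- a functional vanishing on `V`
  obtain ⟨ψ, hψ0, hψV⟩ : ∃ ψ : A →ₗ[k] k, ψ ≠ 0 ∧ ∀ x ∈ V, ψ x = 0 := by
    obtain ⟨ψ, h1, h2⟩ := Submodule.exists_le_ker_of_lt_top V (lt_top_iff_ne_top.2 hne)
    exact ⟨ψ, h1, fun x hx => h2 hx⟩
  -- Apply `hf` to the ideal `(b)`, which is proper because the extension is nonzero at `v`.
  have hnd : ∀ c : k, ∀ b : A, (∀ x, (f + c • ψ) (b * x) = 0) → b = 0 := by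
    intro c b hb
    have hext : ∀ x ∈ V, (f + c • ψ) x = f x := fun x hx => by simp [hψV x hx]
    have hker : ∀ x ∈ Ideal.span {b}, (f + c • ψ) x = 0 := by
      intro x hx
      obtain ⟨z, rfl⟩ := Ideal.mem_span_singleton'.1 hx
      rw [mul_comm]; exact hb z
    have := hf _ hext (Ideal.span {b}) (fun h => hv (by
      rw [← hext v hvV]; exact hker v (h ▸ Submodule.mem_top))) hker
    simpa using this
  -- `f` generates the dual of `A`
  obtain ⟨a, ha⟩ : ∃ a : A, ∀ x, ψ x = f (a * x) := by
    let B : A →ₗ[k] (A →ₗ[k] k) := (LinearMap.mul k A).compr₂ f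
    have hinj : Function.Injective B := by
      rw [← LinearMap.ker_eq_bot, LinearMap.ker_eq_bot']
      intro b hb
      refine hnd 0 b fun x => ?_
      have := LinearMap.congr_fun hb x
      simpa [B] using this
    have hsurj : Function.Surjective B :=
      (LinearMap.injective_iff_surjective_of_finrank_eq_finrank
        (Subspace.dual_finrank_eq (K := k) (V := A)).symm).1 hinj
    obtain ⟨a, ha⟩ := hsurj ψ
    exact ⟨a, fun x => by rw [← ha]; rfl⟩
  -- `f + c • ψ` is `f` precomposed with multiplication by `1 + c • a`; its nondegeneracy makes that
  -- multiplication injective, hence surjective in finite dimension.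
  have hunit : ∀ c : k, IsUnit (1 + c • a) := by
    intro c
    have hinj : Function.Injective (LinearMap.mul k A (1 + c • a)) := by
      rw [← LinearMap.ker_eq_bot, LinearMap.ker_eq_bot']
      intro b hb
      have hb' : (1 + c • a) * b = 0 := hb
      refine hnd c b fun x => ?_
      have : (f + c • ψ) (b * x) = f (((1 + c • a) * b) * x) := by
        simp [ha, add_mul, mul_assoc]
      rw [this, hb']; simp
    obtain ⟨u, hu⟩ := LinearMap.injective_iff_surjective.1 hinj 1
    exact IsUnit.of_mul_eq_one u hu
  -- Modulo `N`, `a` is `∑ c i • y i`. If `c j ≠ 0`, the unit `1 - (c j)⁻¹ • a` multiplies `y j`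
  -- into `N`, so `y j ∈ N` and its term still disappears.
  have haN : a ∈ N := by
    have h1 : a ∈ Submodule.span k (Set.range y) ⊔ N.restrictScalars k := hspan ▸ Submodule.mem_top
    obtain ⟨z, hz, w, hw, rfl⟩ := Submodule.mem_sup.1 h1
    obtain ⟨c, rfl⟩ := (Submodule.mem_span_range_iff_exists_fun k).1 hz
    refine N.add_mem (N.sum_mem fun j _ => ?_) hw
    by_cases hc : c j = 0
    · simp [hc]
    have h2 : (1 + (-(c j)⁻¹) • (∑ i, c i • y i + w)) * y j ∈ N := by
      have h3 : (∑ i, c i • y i) * y j - c j • y j ∈ N := by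
        rw [Finset.sum_mul, ← Finset.add_sum_erase _ _ (Finset.mem_univ j), add_sub_right_comm]
        refine N.add_mem ?_ (N.sum_mem fun i hi => ?_)
        · rw [smul_mul_assoc, ← smul_sub]
          exact Submodule.smul_of_tower_mem N _ (hidem j)
        · rw [smul_mul_assoc]
          exact Submodule.smul_of_tower_mem N _ (hmul i j (Finset.ne_of_mem_erase hi))
      have h4 : (1 + (-(c j)⁻¹) • (∑ i, c i • y i + w)) * y j =
          (-(c j)⁻¹) • (((∑ i, c i • y i) * y j - c j • y j) + w * y j) := by
        rw [add_mul, one_mul, smul_mul_assoc, add_mul, sub_add_eq_add_sub, smul_sub, smul_smul]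
        simp [hc, add_comm]
      rw [h4]
      exact Submodule.smul_of_tower_mem N _ (N.add_mem h3 (N.mul_mem_right _ hw))
    have h5 : y j ∈ N := (Ideal.unit_mul_mem_iff_mem N (hunit _)).1 h2
    exact Submodule.smul_of_tower_mem N _ h5
  apply hψ0
  ext x
  have hx : x ∈ V ⊔ (N ^ m).restrictScalars k := hV ▸ Submodule.mem_top
  obtain ⟨z, hz, w, hw, rfl⟩ := Submodule.mem_sup.1 hx
  have h6 : a * w ∈ N ^ (m + 1) := by
    rw [pow_succ']; exact Ideal.mul_mem_mul haN hw
  rw [hN] at h6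
  have h7 : a * w = 0 := by simpa using h6
  rw [map_add, hψV z hz, ha, h7]; simp

/-! ### Differentiation pairing, dual linear forms, saturation -/

section Action

variable {k : Type*} [Field k] {n : ℕ}

theorem prod_descFactorial_eq_zero {α β : Fin (n + 1) →₀ ℕ} (h : ¬ β ≤ α) :
    (∏ i, ((α i).descFactorial (β i) : k)) = 0 := by
  obtain ⟨i, hi⟩ : ∃ i, α i < β i := by
    by_contra! h'
    exact h h'
  exact Finset.prod_eq_zero (Finset.mem_univ i) (by simp [Nat.descFactorial_eq_zero_iff_lt.2 hi])

theorem diffAction_eq_sum (G : PolyR k n) (F : PolyS k n) :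
    diffAction k n G F = ∑ β ∈ G.support, ∑ α ∈ F.support,
      diffAction k n (monomial β (coeff β G)) (monomial α (coeff α F)) := by
  conv_lhs => rw [← support_sum_monomial_coeff G, ← support_sum_monomial_coeff F]
  simp only [map_sum, LinearMap.sum_apply]
  exact Finset.sum_comm

theorem isHomogeneous_diffAction {G : PolyR k n} {F : PolyS k n} {i j : ℕ}
    (hG : G.IsHomogeneous i) (hF : F.IsHomogeneous j) :
    (diffAction k n G F).IsHomogeneous (j - i) := by
  rw [diffAction_eq_sum]
  refine IsHomogeneous.sum _ _ _ fun β hβ => IsHomogeneous.sum _ _ _ fun α hα => ?_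
  rw [diffAction_monomial]
  by_cases h : β ≤ α
  · apply isHomogeneous_monomial
    have h1 := congrArg Finsupp.degree (tsub_add_cancel_of_le h)
    rw [map_add] at h1
    have h2 : α.degree = j := (hF.degree_eq_sum_deg_support hα).symm
    have h3 : β.degree = i := (hG.degree_eq_sum_deg_support hβ).symm
    omega
  · rw [prod_descFactorial_eq_zero h, mul_zero, monomial_zero]
    exact isHomogeneous_zero _ _ _

theorem diffAction_eq_zero_of_lt {G : PolyR k n} {F : PolyS k n} {i j : ℕ}
    (hG : G.IsHomogeneous i) (hF : F.IsHomogeneous j) (hij : j < i) :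
    diffAction k n G F = 0 := by
  rw [diffAction_eq_sum]
  refine Finset.sum_eq_zero fun β hβ => Finset.sum_eq_zero fun α hα => ?_
  rw [diffAction_monomial, prod_descFactorial_eq_zero, mul_zero, monomial_zero]
  intro h
  have h1 := congrArg Finsupp.degree (tsub_add_cancel_of_le h)
  rw [map_add] at h1
  have h2 : α.degree = j := (hF.degree_eq_sum_deg_support hα).symm
  have h3 : β.degree = i := (hG.degree_eq_sum_deg_support hβ).symm
  omega

theorem coeff_zero_diffAction_monomial (β : Fin (n + 1) →₀ ℕ) (F : PolyS k n) :
    coeff 0 (diffAction k n (monomial β 1) F) = (∏ i, ((β i).factorial : k)) * coeff β F := by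
  induction F using MvPolynomial.induction_on' with
  | add p q hp hq => rw [map_add, coeff_add, coeff_add, hp, hq, mul_add]
  | monomial α c =>
    rw [diffAction_monomial, coeff_monomial, coeff_monomial, one_mul]
    by_cases h : α = β
    · subst h
      simp [Nat.descFactorial_self, mul_comm]
    · rw [if_neg h, mul_zero]
      split_ifs with h1
      · rw [prod_descFactorial_eq_zero, mul_zero]
        exact fun h2 => h (le_antisymm (tsub_eq_zero_iff_le.1 h1) h2)
      · rfl

/-- In the monomial bases the pairing is diagonal with factorial entries, nonzero in characteristic
zero. -/
theorem eq_zero_of_forall_coeff_zero_diffAction [CharZero k] {F : PolyS k n} {e : ℕ}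
    (hF : F.IsHomogeneous e)
    (h : ∀ G : PolyR k n, G.IsHomogeneous e → coeff 0 (diffAction k n G F) = 0) : F = 0 := by
  ext β
  by_cases hβ : β.degree = e
  · have := h _ (isHomogeneous_monomial 1 hβ)
    rw [coeff_zero_diffAction_monomial] at this
    refine (mul_eq_zero.1 this).resolve_left ?_
    exact Finset.prod_ne_zero_iff.2 fun i _ => Nat.cast_ne_zero.2 (Nat.factorial_ne_zero _)
  · simpa using hF.coeff_eq_zero hβ

theorem diffAction_sum_smul_X (f : PolyS k n →ₗ[k] k) {L : PolyS k n} (hL : L.IsHomogeneous 1) :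
    diffAction k n (∑ i, f (X i) • X i) L = C (f L) := by
  rw [← mem_homogeneousSubmodule, homogeneousSubmodule_one_eq_span_X] at hL
  induction hL using Submodule.span_induction with
  | zero => simp
  | add x y _ _ hx hy => simp only [map_add, hx, hy]
  | smul a x _ hx => rw [map_smul, map_smul, hx, smul_eq_mul, C_mul, smul_eq_C_mul]
  | mem x hx =>
    obtain ⟨j, rfl⟩ := hx
    rw [map_sum, LinearMap.sum_apply, Finset.sum_eq_single j]
    · rw [map_smul, LinearMap.smul_apply, X, diffAction_monomial, tsub_self,
        Finset.prod_eq_one, C_apply, smul_monomial]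
      · simp
      · intro i _
        by_cases h : i = j
        · subst h; simp
        · simp [Ne.symm h]
    · intro i _ hij
      rw [map_smul, LinearMap.smul_apply, X, X, diffAction_monomial,
        prod_descFactorial_eq_zero, mul_zero, monomial_zero, smul_zero]
      intro h
      have := h i
      simp [hij.symm] at this
    · simp

theorem exists_dual_linear_forms {ι : Type*} [DecidableEq ι] {L : ι → PolyS k n}
    (hL : ∀ i, (L i).IsHomogeneous 1) (hLind : LinearIndependent k L) :
    ∃ y : ι → PolyR k n, (∀ i, (y i).IsHomogeneous 1) ∧
      ∀ i j, diffAction k n (y i) (L j) = if i = j then 1 else 0 := by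
  obtain ⟨g, hg⟩ := LinearMap.exists_extend (p := Submodule.span k (Set.range L))
    (hLind.repr)
  have hgL : ∀ j, g (L j) = Finsupp.single j 1 := by
    intro j
    have h1 := LinearMap.congr_fun hg ⟨L j, Submodule.subset_span ⟨j, rfl⟩⟩
    rw [LinearMap.comp_apply, Submodule.subtype_apply] at h1
    rw [h1]
    exact hLind.repr_eq_single j _ rfl
  refine ⟨fun i => ∑ t, ((Finsupp.lapply i).comp g) (X t) • X t, fun i => ?_, fun i j => ?_⟩
  · refine IsHomogeneous.sum _ _ _ fun t _ => ?_
    rw [smul_eq_C_mul]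
    exact (isHomogeneous_X _ _).C_mul _
  · rw [diffAction_sum_smul_X _ (hL j)]
    simp only [LinearMap.comp_apply, hgL, Finsupp.lapply_apply, Finsupp.single_apply]
    by_cases h : i = j
    · simp [h]
    · simp [h, Ne.symm h]

theorem exists_diffAction_eq_C {w : PolyR k n} (hw : w.IsHomogeneous 1)
    {L : PolyS k n} (hL : L.IsHomogeneous 1) : ∃ c : k, diffAction k n w L = C c := by
  have h := isHomogeneous_diffAction hw hL
  rw [Nat.sub_self, ← totalDegree_zero_iff_isHomogeneous, totalDegree_eq_zero_iff_eq_C] at h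
  exact ⟨_, h⟩

theorem mem_of_span_X_pow_mul_mem {I : Ideal (PolyR k n)} (hI : ∀ G, (∀ i, X i * G ∈ I) → G ∈ I)
    (t : ℕ) {G : PolyR k n} (hG : ∀ u ∈ Ideal.span (Set.range X) ^ t, u * G ∈ I) : G ∈ I := by
  induction t generalizing G with
  | zero => simpa using hG 1 (by simp)
  | succ t ih =>
    refine ih fun u hu => hI _ fun i => ?_
    rw [← mul_assoc]
    apply hG
    rw [pow_succ']
    exact Ideal.mul_mem_mul (Ideal.subset_span ⟨i, rfl⟩) hu

/-- As `l` does not vanish at `[L]`, the irrelevant ideal lies in `(l) + ℘_L`, so its power `1 + m`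
lies in `(l) + ℘_L ^ m`. That power multiplies `G` into `I`, and saturation concludes. -/
theorem mem_of_mul_mem_of_pointIdeal_pow_le {I : Ideal (PolyR k n)}
    (hI : ∀ G, (∀ i, X i * G ∈ I) → G ∈ I) {L : PolyS k n} (hL : L.IsHomogeneous 1) {m : ℕ}
    (hfat : pointIdeal L ^ m ≤ I) {l : PolyR k n} (hl : l.IsHomogeneous 1)
    (hlL : diffAction k n l L = 1) {G : PolyR k n} (hG : l * G ∈ I) : G ∈ I := by
  have h1 : Ideal.span (Set.range X) ≤ Ideal.span {l} ⊔ pointIdeal L := by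
    rw [Ideal.span_le]
    rintro _ ⟨i, rfl⟩
    obtain ⟨c, hc⟩ := exists_diffAction_eq_C (isHomogeneous_X k i) hL
    have h2 : X i = C c * l + (X i - C c * l) := by ring
    rw [SetLike.mem_coe, h2]
    refine Submodule.add_mem_sup (Ideal.mul_mem_left _ _ (Ideal.mem_span_singleton_self l))
      (Ideal.subset_span ⟨(isHomogeneous_X k i).sub (hl.C_mul c), ?_⟩)
    rw [map_sub, LinearMap.sub_apply, ← smul_eq_C_mul, map_smul, LinearMap.smul_apply, hlL, hc,
      smul_eq_C_mul, mul_one, sub_self]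
  refine mem_of_span_X_pow_mul_mem hI (1 + m) fun u hu => ?_
  have h3 := ((Ideal.pow_right_mono h1 _).trans Ideal.sup_pow_add_le_pow_sup_pow) hu
  rw [pow_one] at h3
  obtain ⟨a, ha, b, hb, rfl⟩ := Submodule.mem_sup.1 h3
  obtain ⟨c, rfl⟩ := Ideal.mem_span_singleton'.1 ha
  rw [add_mul, mul_assoc]
  exact I.add_mem (I.mul_mem_left _ hG) (I.mul_mem_right _ (hfat hb))

end Action

/-! ### Homogenization with respect to a linear form -/

section Homogenize

variable {k : Type*} [Field k] {n : ℕ}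

/-- The homogenization in degree `N` with respect to a linear form `l`: the homogeneous component
of degree `t ≤ N` is multiplied by `l ^ (N - t)`. -/
def homogenize (l : PolyR k n) (N : ℕ) : PolyR k n →ₗ[k] PolyR k n :=
  ∑ t ∈ Finset.range (N + 1), LinearMap.mulLeft k (l ^ (N - t)) ∘ₗ homogeneousComponent t

theorem homogenize_apply (l : PolyR k n) (N : ℕ) (G : PolyR k n) :
    homogenize l N G = ∑ t ∈ Finset.range (N + 1), l ^ (N - t) * homogeneousComponent t G := by
  simp [homogenize]

theorem homogenize_of_isHomogeneous (l : PolyR k n) {N t : ℕ} (ht : t ≤ N) {G : PolyR k n}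
    (hG : G.IsHomogeneous t) : homogenize l N G = l ^ (N - t) * G := by
  rw [homogenize_apply, Finset.sum_eq_single t]
  · rw [homogeneousComponent_eq_self hG]
  · intro u _ hu
    rw [homogeneousComponent_of_mem hG, if_neg hu, mul_zero]
  · intro h
    exact absurd (Finset.mem_range.2 (by omega)) h

theorem isHomogeneous_homogenize {l : PolyR k n} (hl : l.IsHomogeneous 1) (N : ℕ) (G : PolyR k n) :
    (homogenize l N G).IsHomogeneous N := by
  rw [homogenize_apply]
  refine IsHomogeneous.sum _ _ _ fun t ht => ?_
  have h := (hl.pow (N - t)).mul (homogeneousComponent_isHomogeneous t G)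
  rwa [one_mul, Nat.sub_add_cancel (by have := Finset.mem_range.1 ht; omega)] at h

theorem sub_homogenize_mem (l : PolyR k n) {N : ℕ} {G : PolyR k n} (hG : G.totalDegree ≤ N) :
    G - homogenize l N G ∈ Ideal.span {l - 1} := by
  have h1 : G = ∑ t ∈ Finset.range (N + 1), homogeneousComponent t G := by
    conv_lhs => rw [← sum_homogeneousComponent G]
    refine Finset.sum_subset (by simpa using hG) fun t _ ht => ?_
    exact homogeneousComponent_eq_zero _ _ (by simpa using ht)
  rw [homogenize_apply]
  nth_rw 1 [h1]
  rw [← Finset.sum_sub_distrib]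
  refine Ideal.sum_mem _ fun t _ => ?_
  have h2 : homogeneousComponent t G - l ^ (N - t) * homogeneousComponent t G =
      -((l ^ (N - t) - 1) * homogeneousComponent t G) := by ring
  rw [h2, Ideal.mem_span_singleton, dvd_neg]
  exact (sub_one_dvd_pow_sub_one l _).mul_right _

theorem homogenize_sub_one_mul {l : PolyR k n} (hl : l.IsHomogeneous 1) {N : ℕ} {b : PolyR k n}
    (hb : b.totalDegree < N) : homogenize l N ((l - 1) * b) = 0 := by
  rw [← sum_homogeneousComponent b, Finset.mul_sum, map_sum]
  refine Finset.sum_eq_zero fun t ht => ?_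
  have ht' : t < N := by have := Finset.mem_range.1 ht; omega
  have h1 := homogeneousComponent_isHomogeneous t b
  rw [sub_mul, one_mul, map_sub, homogenize_of_isHomogeneous l ht'.le h1,
    homogenize_of_isHomogeneous l (t := 1 + t) (by omega) (hl.mul h1), ← mul_assoc, ← pow_succ,
    show N - (1 + t) + 1 = N - t by omega, sub_self]

theorem homogenize_mem {I : Ideal (PolyR k n)}
    (hI : I.IsHomogeneous (homogeneousSubmodule (Fin (n + 1)) k)) (l : PolyR k n) (N : ℕ)
    {G : PolyR k n} (hG : G ∈ I) : homogenize l N G ∈ I := by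
  rw [homogenize_apply]
  exact I.sum_mem fun t _ => I.mul_mem_left _ (homogeneousComponent_mem_of_mem hI hG t)

theorem pow_mul_mem_imp {I : Ideal (PolyR k n)} {l : PolyR k n}
    (hnzd : ∀ G, l * G ∈ I → G ∈ I) (t : ℕ) {G : PolyR k n} (hG : l ^ t * G ∈ I) : G ∈ I := by
  induction t with
  | zero => simpa using hG
  | succ t ih => exact ih (hnzd _ (by rwa [← mul_assoc, ← pow_succ']))

/-- Homogenizing in a large degree kills the multiple of `l - 1` and leaves a power of `l` times `G`
in `I`; that power cancels. -/
theorem mem_of_mem_sup_span_sub_one {I : Ideal (PolyR k n)}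
    (hI : I.IsHomogeneous (homogeneousSubmodule (Fin (n + 1)) k)) {l : PolyR k n}
    (hl : l.IsHomogeneous 1) (hnzd : ∀ G, l * G ∈ I → G ∈ I) {t : ℕ} {G : PolyR k n}
    (hG : G.IsHomogeneous t) (hmem : G ∈ I ⊔ Ideal.span {l - 1}) : G ∈ I := by
  obtain ⟨a, ha, c, hc, rfl⟩ := Submodule.mem_sup.1 hmem
  obtain ⟨b, rfl⟩ := Ideal.mem_span_singleton.1 hc
  let N := b.totalDegree + 1 + t
  have h1 : homogenize l N (a + (l - 1) * b) ∈ I := by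
    rw [map_add, homogenize_sub_one_mul hl (by omega), add_zero]
    exact homogenize_mem hI l N ha
  rw [homogenize_of_isHomogeneous l (by omega) hG] at h1
  exact pow_mul_mem_imp hnzd _ h1

end Homogenize

/-! ### Hilbert function, length and regularity read in a chart -/

section Chart

variable {k : Type*} [Field k] {n : ℕ}

/-- The image of the forms of degree `i` in the coordinate ring of the chart `l ≠ 0`. -/
def formsInChart (I : Ideal (PolyR k n)) (l : PolyR k n) (i : ℕ) :
    Submodule k (PolyR k n ⧸ (I ⊔ Ideal.span {l - 1})) :=
  (homogeneousSubmodule (Fin (n + 1)) k i).map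
    (Ideal.Quotient.mkₐ k (I ⊔ Ideal.span {l - 1})).toLinearMap

theorem mk_mem_formsInChart (I : Ideal (PolyR k n)) {l : PolyR k n} (hl : l.IsHomogeneous 1)
    {i : ℕ} {G : PolyR k n} (hG : G.totalDegree ≤ i) :
    Ideal.Quotient.mk (I ⊔ Ideal.span {l - 1}) G ∈ formsInChart I l i := by
  refine ⟨homogenize l i G, isHomogeneous_homogenize hl i G, ?_⟩
  exact (Ideal.Quotient.eq.2 (le_sup_right (a := I) (sub_homogenize_mem l hG))).symm

theorem formsInChart_mono (I : Ideal (PolyR k n)) {l : PolyR k n} (hl : l.IsHomogeneous 1) :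
    Monotone (formsInChart I l) := by
  rintro i j hij _ ⟨G, hG, rfl⟩
  exact mk_mem_formsInChart I hl ((IsHomogeneous.totalDegree_le hG).trans hij)

instance finite_homogeneousSubmodule (i : ℕ) :
    Module.Finite k (homogeneousSubmodule (Fin (n + 1)) k i) :=
  Module.Finite.iff_fg.2 (homogeneousSubmodule_fg _ _ i)

instance finite_formsInChart (I : Ideal (PolyR k n)) (l : PolyR k n) (i : ℕ) :
    Module.Finite k (formsInChart I l i) :=
  inferInstanceAs (Module.Finite k (Submodule.map _ _))

theorem formsInChart_one_pow (I : Ideal (PolyR k n)) (l : PolyR k n) (i : ℕ) :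
    formsInChart I l 1 ^ i = formsInChart I l i := by
  rw [formsInChart, formsInChart, ← Submodule.map_pow, homogeneousSubmodule_one_pow]

theorem finrank_formsInChart_le (Z : ZeroDimScheme k n) (l : PolyR k n) (i : ℕ) :
    Module.finrank k (formsInChart Z.ideal l i) ≤ Z.hilbertFunction i := by
  let g : homogeneousSubmodule (Fin (n + 1)) k i →ₗ[k] formsInChart Z.ideal l i :=
    (Ideal.Quotient.mkₐ k (Z.ideal ⊔ Ideal.span {l - 1})).toLinearMap.submoduleMap _
  have hg : Function.Surjective g := LinearMap.submoduleMap_surjective _ _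
  let K := (Z.ideal.restrictScalars k).comap (homogeneousSubmodule (Fin (n + 1)) k i).subtype
  have hK : K ≤ LinearMap.ker g := by
    intro G hG
    rw [LinearMap.mem_ker]
    apply Subtype.ext
    exact Ideal.Quotient.eq_zero_iff_mem.2 (le_sup_left (b := Ideal.span {l - 1}) hG)
  refine LinearMap.finrank_le_finrank_of_surjective (f := K.liftQ g hK) fun x => ?_
  obtain ⟨G, rfl⟩ := hg x
  exact ⟨K.mkQ G, rfl⟩

theorem hilbertFunction_eq_finrank_formsInChart (Z : ZeroDimScheme k n) {l : PolyR k n}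
    (hl : l.IsHomogeneous 1) (hnzd : ∀ G, l * G ∈ Z.ideal → G ∈ Z.ideal) (i : ℕ) :
    Z.hilbertFunction i = Module.finrank k (formsInChart Z.ideal l i) := by
  refine le_antisymm ?_ (finrank_formsInChart_le Z l i)
  let g : homogeneousSubmodule (Fin (n + 1)) k i →ₗ[k] formsInChart Z.ideal l i :=
    (Ideal.Quotient.mkₐ k (Z.ideal ⊔ Ideal.span {l - 1})).toLinearMap.submoduleMap _
  have hK : (Z.ideal.restrictScalars k).comap (homogeneousSubmodule (Fin (n + 1)) k i).subtype =
      LinearMap.ker g := by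
    ext G
    rw [LinearMap.mem_ker]
    constructor
    · intro hG
      apply Subtype.ext
      exact Ideal.Quotient.eq_zero_iff_mem.2 (le_sup_left (b := Ideal.span {l - 1}) hG)
    · intro hG
      exact mem_of_mem_sup_span_sub_one Z.homogeneous hl hnzd G.2
        (Ideal.Quotient.eq_zero_iff_mem.1 (congrArg Subtype.val hG))
  rw [ZeroDimScheme.hilbertFunction, hK, g.quotKerEquivRange.finrank_eq]
  exact Submodule.finrank_le _

/-- From degree `d` on, the Hilbert function is constantly the dimension of this chart. In any other
chart, finitely many independent elements are images of forms of one large degree, so the same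
number bounds them. -/
theorem length_eq_of_formsInChart_eq_top (Z : ZeroDimScheme k n) {l : PolyR k n}
    (hl : l.IsHomogeneous 1) (hnzd : ∀ G, l * G ∈ Z.ideal → G ∈ Z.ideal) {d : ℕ}
    (hd : formsInChart Z.ideal l d = ⊤) : Z.length = Z.hilbertFunction d := by
  have hfin : Module.Finite k (PolyR k n ⧸ (Z.ideal ⊔ Ideal.span {l - 1})) :=
    Module.finite_def.2 (hd ▸ Module.Finite.iff_fg.1 (finite_formsInChart Z.ideal l d))
  have hHF : ∀ i, d ≤ i → Z.hilbertFunction i =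
      Module.finrank k (PolyR k n ⧸ (Z.ideal ⊔ Ideal.span {l - 1})) := by
    intro i hi
    have h1 : formsInChart Z.ideal l i = ⊤ :=
      top_le_iff.1 (hd.symm.le.trans (formsInChart_mono Z.ideal hl hi))
    rw [hilbertFunction_eq_finrank_formsInChart Z hl hnzd, h1, finrank_top]
  refine le_antisymm (iSup₂_le fun l' hl' => ?_) ?_
  · have hrank : Module.rank k (PolyR k n ⧸ (Z.ideal ⊔ Ideal.span {l' - 1})) ≤
        Z.hilbertFunction d := by
      refine rank_le fun s hs => ?_
      obtain ⟨g, hg⟩ := (Ideal.Quotient.mk_surjective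
        (I := Z.ideal ⊔ Ideal.span {l' - 1})).hasRightInverse
      let N := d + s.sup fun x => (g x).totalDegree
      have h1 : Submodule.span k (s : Set (PolyR k n ⧸ (Z.ideal ⊔ Ideal.span {l' - 1}))) ≤
          formsInChart Z.ideal l' N := by
        refine Submodule.span_le.2 fun x hx => ?_
        have h2 := mk_mem_formsInChart Z.ideal hl' (i := N) (G := g x)
          ((Finset.le_sup (f := fun x => (g x).totalDegree) hx).trans (Nat.le_add_left _ _))
        rwa [hg x] at h2
      have h3 : s.card = Module.finrank k (Submodule.span k
          (s : Set (PolyR k n ⧸ (Z.ideal ⊔ Ideal.span {l' - 1})))) :=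
        (finrank_span_finset_eq_card hs).symm
      rw [h3, hHF d le_rfl, ← hHF N (Nat.le_add_right _ _)]
      exact (Submodule.finrank_mono h1).trans (finrank_formsInChart_le Z l' N)
    rw [Module.length_eq_rank]
    simpa using Cardinal.toENat.monotone' hrank
  · rw [hHF d le_rfl, ← Module.length_eq_finrank]
    exact le_iSup₂ (f := fun (l : PolyR k n) (_ : l.IsHomogeneous 1) =>
      Module.length k (PolyR k n ⧸ (Z.ideal ⊔ Ideal.span {l - 1}))) l hl

theorem isRegularInDegree_of_formsInChart_eq_top (Z : ZeroDimScheme k n) {l : PolyR k n}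
    (hl : l.IsHomogeneous 1) (hnzd : ∀ G, l * G ∈ Z.ideal → G ∈ Z.ideal) {d : ℕ}
    (hd : formsInChart Z.ideal l d = ⊤) : Z.IsRegularInDegree d := by
  have hd' : formsInChart Z.ideal l (d + 1) = ⊤ :=
    top_le_iff.1 (hd.symm.le.trans (formsInChart_mono Z.ideal hl (Nat.le_succ d)))
  exact iInf₂_le d ⟨(length_eq_of_formsInChart_eq_top Z hl hnzd hd).symm,
    (length_eq_of_formsInChart_eq_top Z hl hnzd hd').symm⟩

end Chart

/-! ### Apolar subschemes and ideals in the kernel of a functional -/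

section Irredundant

variable {k : Type*} [Field k] {n : ℕ}

theorem homogeneousComponent_linear_mul {l : PolyR k n} (hl : l.IsHomogeneous 1) (t : ℕ)
    (G : PolyR k n) : homogeneousComponent (1 + t) (l * G) = l * homogeneousComponent t G := by
  conv_lhs => rw [← sum_homogeneousComponent G, Finset.mul_sum, map_sum]
  have h1 : ∀ u, homogeneousComponent (1 + t) (l * homogeneousComponent u G) =
      if t = u then l * homogeneousComponent u G else 0 := fun u => by
    rw [homogeneousComponent_of_mem (hl.mul (homogeneousComponent_isHomogeneous u G))]
    simp
  simp only [h1, Finset.sum_ite_eq]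
  split_ifs with h
  · rfl
  · rw [homogeneousComponent_eq_zero _ _ (by simpa using h), mul_zero]

theorem mul_mem_of_forall_X_mul_mem {I : Ideal (PolyR k n)} {l : PolyR k n}
    (hl : l.IsHomogeneous 1) {G : PolyR k n} (hG : ∀ i, X i * G ∈ I) : l * G ∈ I := by
  rw [← mem_homogeneousSubmodule, homogeneousSubmodule_one_eq_span_X] at hl
  induction hl using Submodule.span_induction with
  | zero => simp
  | add x y _ _ hx hy => rw [add_mul]; exact I.add_mem hx hy
  | smul a x _ hx => rw [smul_mul_assoc]; exact Submodule.smul_of_tower_mem I a hx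
  | mem x hx => obtain ⟨j, rfl⟩ := hx; exact hG j

/-- `l` is a nonzerodivisor modulo `I` but not a unit there, having no constant term; dividing by it
lowers the dimension by at least one and leaves a nonzero ring. -/
theorem one_le_ringKrullDim_quotient {I : Ideal (PolyR k n)}
    (hI : I.IsHomogeneous (homogeneousSubmodule (Fin (n + 1)) k)) (hne : I ≠ ⊤)
    {l : PolyR k n} (hl : l.IsHomogeneous 1) (hnzd : ∀ G, l * G ∈ I → G ∈ I) :
    1 ≤ ringKrullDim (PolyR k n ⧸ I) := by
  have hcoeff : ∀ G ∈ I, coeff 0 G = 0 := by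
    intro G hG
    by_contra h
    have h1 := homogeneousComponent_mem_of_mem hI hG 0
    rw [homogeneousComponent_zero] at h1
    exact hne (Ideal.eq_top_of_isUnit_mem I h1 ((isUnit_iff_ne_zero.2 h).map C))
  have hreg : Ideal.Quotient.mk I l ∈ nonZeroDivisors (PolyR k n ⧸ I) := by
    rw [mem_nonZeroDivisors_iff_right]
    intro x hx
    obtain ⟨G, rfl⟩ := Ideal.Quotient.mk_surjective x
    rw [← map_mul, Ideal.Quotient.eq_zero_iff_mem, mul_comm] at hx
    exact Ideal.Quotient.eq_zero_iff_mem.2 (hnzd G hx)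
  have hnt : Nontrivial ((PolyR k n ⧸ I) ⧸ Ideal.span {Ideal.Quotient.mk I l}) := by
    rw [Ideal.Quotient.nontrivial_iff, Ne, Ideal.span_singleton_eq_top]
    intro hu
    obtain ⟨x, hx⟩ := isUnit_iff_exists_inv.1 hu
    obtain ⟨G, rfl⟩ := Ideal.Quotient.mk_surjective x
    rw [← map_mul, ← map_one (Ideal.Quotient.mk I), Ideal.Quotient.eq] at hx
    have h2 := hcoeff _ hx
    have h3 : constantCoeff l = 0 := by
      rw [constantCoeff_eq]
      exact hl.coeff_eq_zero (by simp)
    rw [← constantCoeff_eq, map_sub, map_mul, h3] at h2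
    simp at h2
  have h4 := ringKrullDim_quotient_succ_le_of_nonZeroDivisor hreg
  refine le_trans ?_ h4
  have h5 : (0 : WithBot ℕ∞) ≤
      ringKrullDim ((PolyR k n ⧸ I) ⧸ Ideal.span {Ideal.Quotient.mk I l}) :=
    ringKrullDim_nonneg_of_nontrivial
  calc (1 : WithBot ℕ∞) = 0 + 1 := (zero_add 1).symm
    _ ≤ _ := by gcongr

/-- Apolarity can be tested in degree `d`: a form `G` of lower degree is multiplied by all forms `H`
of the complementary degree, and the pairing is perfect. -/
theorem ideal_le_ann_of_forall_coeff_zero [CharZero k] {I : Ideal (PolyR k n)}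
    (hI : I.IsHomogeneous (homogeneousSubmodule (Fin (n + 1)) k)) {d : ℕ} {F : PolyS k n}
    (hF : F.IsHomogeneous d)
    (h : ∀ G ∈ I, G.IsHomogeneous d → coeff 0 (diffAction k n G F) = 0) : I ≤ ann F := by
  intro G hG
  rw [← sum_homogeneousComponent G]
  refine Ideal.sum_mem _ fun t _ => ?_
  have h1 := homogeneousComponent_isHomogeneous t G
  have h2 := homogeneousComponent_mem_of_mem hI hG t
  change diffAction k n _ F = 0
  by_cases ht : d < t
  · exact diffAction_eq_zero_of_lt h1 hF ht
  · refine eq_zero_of_forall_coeff_zero_diffAction (isHomogeneous_diffAction h1 hF) fun H hH => ?_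
    rw [← diffAction_mul]
    refine h _ (I.mul_mem_left _ h2) ?_
    have := hH.mul h1
    rwa [Nat.sub_add_cancel (not_lt.1 ht)] at this

theorem ZeroDimScheme.IsIrredundant.eq_bot_of_le_ker [CharZero k] {Z : ZeroDimScheme k n} {d : ℕ}
    {F : PolyS k n} (hirr : Z.IsIrredundant F) (hF : F.IsHomogeneous d) {l : PolyR k n}
    (hl : l.IsHomogeneous 1)
    (f : (PolyR k n ⧸ (Z.ideal ⊔ Ideal.span {l - 1})) →ₗ[k] k)
    (hf : ∀ G : PolyR k n, G.IsHomogeneous d →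
      f (Ideal.Quotient.mk _ G) = coeff 0 (diffAction k n G F))
    (K : Ideal (PolyR k n ⧸ (Z.ideal ⊔ Ideal.span {l - 1}))) (hK : K ≠ ⊤)
    (hker : ∀ x ∈ K, f x = 0) : K = ⊥ := by
  by_contra hbot
  let P : Ideal (PolyR k n) := K.comap (Ideal.Quotient.mk (Z.ideal ⊔ Ideal.span {l - 1}))
  have hsup : Z.ideal ⊔ Ideal.span {l - 1} ≤ P := by
    intro G hG
    rw [Ideal.mem_comap, Ideal.Quotient.eq_zero_iff_mem.2 hG]
    exact K.zero_mem
  -- The ideal of the subscheme cut out by `K`. Since `l - 1 ∈ P`, `l` is a nonzerodivisor modulo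
  -- `I'`, which yields both saturation and dimension zero.
  let I' := (P.homogeneousCore (homogeneousSubmodule (Fin (n + 1)) k)).toIdeal
  have hI'P : I' ≤ P := Ideal.toIdeal_homogeneousCore_le _ _
  have hI'hom : I'.IsHomogeneous (homogeneousSubmodule (Fin (n + 1)) k) :=
    HomogeneousIdeal.isHomogeneous _
  have hmem : ∀ {t : ℕ} {G : PolyR k n}, G.IsHomogeneous t → G ∈ P → G ∈ I' := fun hG hGP =>
    Ideal.mem_homogeneousCore_of_homogeneous_of_mem ⟨_, hG⟩ hGP
  have hPtop : P ≠ ⊤ := fun h => hK (by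
    rw [← Ideal.map_comap_of_surjective _ Ideal.Quotient.mk_surjective K]
    change Ideal.map _ P = ⊤
    rw [h, Ideal.map_top])
  have hlP : l - 1 ∈ P := hsup (le_sup_right (a := Z.ideal) (Ideal.mem_span_singleton_self _))
  have hnzd' : ∀ G, l * G ∈ I' → G ∈ I' := by
    intro G hG
    rw [← sum_homogeneousComponent G]
    refine Ideal.sum_mem _ fun t _ => hmem (homogeneousComponent_isHomogeneous t G) ?_
    have h1 := hI'P (homogeneousComponent_mem_of_mem hI'hom hG (1 + t))
    rw [homogeneousComponent_linear_mul hl] at h1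
    have h2 : homogeneousComponent t G =
        l * homogeneousComponent t G - (l - 1) * homogeneousComponent t G := by ring
    rw [h2]
    exact P.sub_mem h1 (P.mul_mem_right _ hlP)
  have hle : Z.ideal ≤ I' := by
    intro G hG
    rw [← sum_homogeneousComponent G]
    exact Ideal.sum_mem _ fun t _ => hmem (homogeneousComponent_isHomogeneous t G)
      (hsup (le_sup_left (b := Ideal.span {l - 1})
        (homogeneousComponent_mem_of_mem Z.homogeneous hG t)))
  have hdim : ringKrullDim (PolyR k n ⧸ I') = 1 := by
    refine le_antisymm ?_ (one_le_ringKrullDim_quotient hI'hom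
      (fun h => hPtop (top_le_iff.1 (h ▸ hI'P))) hl hnzd')
    rw [← Z.dim_eq_zero]
    exact ringKrullDim_le_of_surjective (Ideal.Quotient.factor hle)
      (Ideal.Quotient.factor_surjective hle)
  let Z' : ZeroDimScheme k n :=
    ⟨I', hI'hom, fun G hG => hnzd' G (mul_mem_of_forall_X_mul_mem hl hG), hdim⟩
  refine hirr.2 ⟨Z', lt_of_le_of_ne hle fun heq => hbot ?_, ?_⟩
  · rw [eq_bot_iff]
    intro x hx
    obtain ⟨G, rfl⟩ := Ideal.Quotient.mk_surjective x
    have h1 := le_sup_right (a := Z.ideal) (sub_homogenize_mem l (le_refl G.totalDegree))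
    have h2 : homogenize l G.totalDegree G ∈ P := by
      have h3 := P.sub_mem (show G ∈ P from hx) (hsup h1)
      rwa [sub_sub_cancel] at h3
    have h4 : homogenize l G.totalDegree G ∈ Z.ideal := by
      rw [heq]
      exact hmem (isHomogeneous_homogenize hl _ G) h2
    have h5 := Ideal.add_mem _ h1 (le_sup_left (b := Ideal.span {l - 1}) h4)
    rw [sub_add_cancel] at h5
    exact Ideal.mem_bot.2 (Ideal.Quotient.eq_zero_iff_mem.2 h5)
  · exact ideal_le_ann_of_forall_coeff_zero hI'hom hF fun G hG hGd => by
      rw [← hf G hGd]; exact hker _ (hI'P hG)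

/-- The forms of degree `d` vanishing in the chart are exactly those in `I(Z)`, and these annihilate
`F`; the functional descends to the image and extends linearly. -/
theorem ZeroDimScheme.IsApolar.exists_functional {Z : ZeroDimScheme k n} {F : PolyS k n}
    (hZ : Z.IsApolar F) {l : PolyR k n} (hl : l.IsHomogeneous 1)
    (hnzd : ∀ G, l * G ∈ Z.ideal → G ∈ Z.ideal) (d : ℕ) :
    ∃ f : (PolyR k n ⧸ (Z.ideal ⊔ Ideal.span {l - 1})) →ₗ[k] k, ∀ G : PolyR k n,
      G.IsHomogeneous d → f (Ideal.Quotient.mk _ G) = coeff 0 (diffAction k n G F) := by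
  let g : homogeneousSubmodule (Fin (n + 1)) k d →ₗ[k]
      PolyR k n ⧸ (Z.ideal ⊔ Ideal.span {l - 1}) :=
    (Ideal.Quotient.mkₐ k (Z.ideal ⊔ Ideal.span {l - 1})).toLinearMap ∘ₗ Submodule.subtype _
  let e : homogeneousSubmodule (Fin (n + 1)) k d →ₗ[k] k :=
    lcoeff k 0 ∘ₗ (diffAction k n).flip F ∘ₗ Submodule.subtype _
  have he : e ∈ LinearMap.range g.dualMap := by
    rw [LinearMap.range_dualMap_eq_dualAnnihilator_ker, Submodule.mem_dualAnnihilator]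
    intro G hG
    have h1 : (G : PolyR k n) ∈ Z.ideal :=
      mem_of_mem_sup_span_sub_one Z.homogeneous hl hnzd G.2
        (Ideal.Quotient.eq_zero_iff_mem.1 (LinearMap.mem_ker.1 hG))
    have h2 : diffAction k n (G : PolyR k n) F = 0 := hZ h1
    change coeff 0 (diffAction k n (G : PolyR k n) F) = 0
    rw [h2, coeff_zero]
  obtain ⟨f, hf⟩ := he
  exact ⟨f, fun G hG => LinearMap.congr_fun hf ⟨G, hG⟩⟩

end Irredundant

end Apolarity

end

/-! ### The main theorem -/

open Apolarity MvPolynomial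

theorem mainTheorem7 {k : Type*} [Field k] [IsAlgClosed k] [CharZero k] (n d s : ℕ)
    (F : Apolarity.PolyS k n) (hF : F.IsHomogeneous d)
    (L : Fin s → Apolarity.PolyS k n) (hL : ∀ i, (L i).IsHomogeneous 1)
    (hLind : LinearIndependent k L)
    (Z : Apolarity.ZeroDimScheme k n) (Zc : Fin s → Apolarity.ZeroDimScheme k n)
    (hZ : Z.ideal = ⨅ i, (Zc i).ideal)
    (hfat : ∀ i, Apolarity.pointIdeal (L i) ^ (⌈(d : ℚ) / 2⌉₊ + 1) ≤ (Zc i).ideal)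
    (hirr : Z.IsIrredundant F) :
    Z.IsRegularInDegree d := by

  obtain ⟨y, hy, hyL⟩ := exists_dual_linear_forms hL hLind
  let l : PolyR k n := ∑ i, y i
  have hl : l.IsHomogeneous 1 := IsHomogeneous.sum _ _ _ fun i _ => hy i
  have hlL : ∀ j, diffAction k n l (L j) = 1 := fun j => by
    simp [l, map_sum, LinearMap.sum_apply, hyL]
  have hnzd : ∀ G, l * G ∈ Z.ideal → G ∈ Z.ideal := by
    intro G hG
    rw [hZ, Ideal.mem_iInf] at hG ⊢
    exact fun i => mem_of_mul_mem_of_pointIdeal_pow_le (Zc i).saturated (hL i) (hfat i) hl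
      (hlL i) (hG i)
  refine isRegularInDegree_of_formsInChart_eq_top Z hl hnzd ?_
  let π := Ideal.Quotient.mk (Z.ideal ⊔ Ideal.span {l - 1})
  -- Equations of degree at most 2 for the set of points `[L j]`: those of their linear span, and
  -- the products of distinct coordinates on it.
  let T : Set (PolyR k n) := {w | w.IsHomogeneous 1 ∧ ∀ j, diffAction k n w (L j) = 0} ∪
    {g | ∃ i j, i ≠ j ∧ g = y i * y j}
  have hTL : ∀ j, Ideal.span T ≤ pointIdeal (L j) := by
    intro j
    have hyp : ∀ i, i ≠ j → y i ∈ pointIdeal (L j) := fun i hij =>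
      Ideal.subset_span ⟨hy i, by rw [hyL, if_neg hij]⟩
    rw [Ideal.span_le]
    rintro _ (⟨h1, h2⟩ | ⟨i, i', hne, rfl⟩)
    · exact Ideal.subset_span ⟨h1, h2 j⟩
    · by_cases hij : i = j
      · exact Ideal.mul_mem_left _ _ (hyp i' (hij ▸ hne.symm))
      · exact Ideal.mul_mem_right _ _ (hyp i hij)
  let N := Ideal.span (π '' T)
  have hN : N ^ (⌈(d : ℚ) / 2⌉₊ + 1) = ⊥ := by
    rw [eq_bot_iff, show N = (Ideal.span T).map π from (Ideal.map_span π T).symm,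
      ← Ideal.map_pow, Ideal.map_le_iff_le_comap]
    intro G hG
    refine Ideal.mem_bot.2 (Ideal.Quotient.eq_zero_iff_mem.2 (Ideal.mem_sup_left ?_))
    rw [hZ, Ideal.mem_iInf]
    exact fun i => hfat i (Ideal.pow_right_mono (hTL i) _ hG)
  have hmul : ∀ i j, i ≠ j → π (y i) * π (y j) ∈ N := fun i j hij =>
    Ideal.subset_span ⟨y i * y j, Or.inr ⟨i, j, hij, rfl⟩, map_mul _ _ _⟩
  have hπl : π l = 1 := by
    rw [← map_one π]
    exact Ideal.Quotient.eq.2 (le_sup_right (a := Z.ideal) (Ideal.mem_span_singleton_self _))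
  have hsum : ∑ i, π (y i) = 1 := by rw [← map_sum, ← hπl]
  have hone : 1 ∈ Submodule.span k (Set.range fun i => π (y i)) ⊔ N.restrictScalars k := by
    rw [← hsum]
    exact sum_mem fun i _ => Submodule.mem_sup_left (Submodule.subset_span ⟨i, rfl⟩)
  have hlin : ∀ G : PolyR k n, G.IsHomogeneous 1 →
      π G ∈ Submodule.span k (Set.range fun i => π (y i)) ⊔ N.restrictScalars k := by
    intro G hG
    choose c hc using fun j => exists_diffAction_eq_C hG (hL j)
    have h1 : G = ∑ i, c i • y i + (G - ∑ i, c i • y i) := by ring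
    rw [h1, map_add, map_sum]
    have hT : G - ∑ i, c i • y i ∈ T := by
      refine Or.inl ⟨hG.sub (IsHomogeneous.sum _ _ _ fun i _ => ?_), fun j => ?_⟩
      · rw [smul_eq_C_mul]
        exact (hy i).C_mul _
      · rw [map_sub, LinearMap.sub_apply, hc, map_sum, LinearMap.sum_apply,
          Finset.sum_eq_single j]
        · rw [map_smul, LinearMap.smul_apply, hyL, if_pos rfl, smul_eq_C_mul, mul_one, sub_self]
        · intro i _ hij
          rw [map_smul, LinearMap.smul_apply, hyL, if_neg hij, smul_zero]
        · simp
    have hTN : π (G - ∑ i, c i • y i) ∈ N := Ideal.subset_span ⟨_, hT, rfl⟩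
    refine Submodule.add_mem_sup (sum_mem fun i _ => ?_) hTN
    have hyi : π (y i) ∈ Submodule.span k (Set.range fun i => π (y i)) :=
      Submodule.subset_span ⟨i, rfl⟩
    exact Submodule.smul_mem _ (c i) hyi
  have hspan : Submodule.span k (Set.range fun i => π (y i)) ⊔ N.restrictScalars k = ⊤ := by
    refine eq_top_iff.2 fun x _ => ?_
    obtain ⟨G, rfl⟩ := Ideal.Quotient.mk_surjective x
    induction G using MvPolynomial.induction_on with
    | C a =>
      have h1 : π (C a) = a • 1 := by rw [← mul_one (C a), ← smul_eq_C_mul]; rfl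
      change π (C a) ∈ _
      rw [h1]
      exact Submodule.smul_mem _ a hone
    | add p q hp hq => exact add_mem (hp trivial) (hq trivial)
    | mul_X p i hp =>
      rw [map_mul]
      exact mul_mem_span_sup N _ hmul hsum (hp trivial) (hlin _ (isHomogeneous_X _ _))
  have hV0 : ∀ i, 1 ∈ formsInChart Z.ideal l i := fun i => by
    have := mk_mem_formsInChart Z.ideal hl (i := i) (G := 1) (by simp)
    rwa [map_one] at this
  have hV1 : ∀ G : PolyR k n, G.IsHomogeneous 1 → π G ∈ formsInChart Z.ideal l 1 :=
    fun G hG => ⟨G, hG, rfl⟩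
  have hpow := pow_sup_span_pow_eq_top (formsInChart Z.ideal l 1) (hV0 1) (π '' T)
    (by
      rintro _ ⟨_, ⟨h1, h2⟩ | ⟨i, j, -, rfl⟩, rfl⟩
      · rw [SetLike.mem_coe, pow_two, ← mul_one (π _)]
        exact Submodule.mul_mem_mul (hV1 _ h1) (hV0 1)
      · rw [SetLike.mem_coe, pow_two, map_mul]
        exact Submodule.mul_mem_mul (hV1 _ (hy i)) (hV1 _ (hy j)))
    (by
      rw [eq_top_iff, ← hspan]
      refine sup_le_sup_right (Submodule.span_le.2 ?_) _
      rintro _ ⟨i, rfl⟩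
      exact hV1 _ (hy i))
  -- Since `N ^ (m + 1) = 0`, forms of degree `2 * m + 1` already fill the chart ring.
  have hfin : Module.Finite k (PolyR k n ⧸ (Z.ideal ⊔ Ideal.span {l - 1})) := by
    have h1 := hpow ⌈(d : ℚ) / 2⌉₊
    rw [show Ideal.span (π '' T) ^ (⌈(d : ℚ) / 2⌉₊ + 1) = ⊥ from hN, Submodule.restrictScalars_bot,
      sup_bot_eq, formsInChart_one_pow] at h1
    exact Module.finite_def.2 (h1 ▸ Module.Finite.iff_fg.1 (finite_formsInChart Z.ideal l _))
  have hVN : formsInChart Z.ideal l d ⊔ (N ^ ⌈(d : ℚ) / 2⌉₊).restrictScalars k = ⊤ := by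
    by_cases h0 : ⌈(d : ℚ) / 2⌉₊ = 0
    · rw [h0, show N ^ 0 = ⊤ from (pow_zero N).trans Ideal.one_eq_top,
        Submodule.restrictScalars_top, sup_top_eq]
    · obtain ⟨q, hq⟩ := Nat.exists_eq_succ_of_ne_zero h0
      -- The exponent `⌈d/2⌉` enters here: with `q = ⌈d/2⌉ - 1 < d/2`, the degree `2 * q + 1` needed
      -- to fill `A` modulo `N ^ (q + 1)` does not exceed `d`.
      have hqd : 2 * q + 1 ≤ d := by
        have h1 : q < ⌈(d : ℚ) / 2⌉₊ := by omega
        rw [Nat.lt_ceil, lt_div_iff₀ two_pos] at h1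
        have h2 : q * 2 < d := by exact_mod_cast h1
        omega
      rw [hq, eq_top_iff, ← hpow q, formsInChart_one_pow]
      exact sup_le_sup_right (formsInChart_mono Z.ideal hl hqd) _
  obtain ⟨f, hf⟩ := hirr.1.exists_functional hl hnzd d
  refine eq_top_of_forall_extension N (fun i => π (y i)) _ hN hmul hsum hspan _ (hV0 d) hVN f
    fun φ hφ K hK hker => ?_
  exact hirr.eq_bot_of_le_ker hF hl φ
    (fun G hG => by rw [← hf G hG]; exact hφ (π G) ⟨G, hG, rfl⟩) K hK hker
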